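/- Let $f:\mathbb R^n\to\mathbb R$ be twice continuously differentiable with $\gamma$-Lipschitz Hessian, $\gamma>0$, i.e. $\|\nabla^2 f(z)-\nabla^2 f(z')\|\le\gamma\|z-z'\|$ (spectral norm), and let $x_*$ be a minimizer of $f$. For a symmetric matrix $H$ and points $z,w$ put $$\tilde f_\eta(z;w)=f(w)+\langle\nabla f(w),z-w\rangle+\tfrac12\langle H(z-w),z-w\rangle+\tfrac{\eta}{6}\|z-w\|^3 ,$$ where for $w=w_t$ the matrix is $H=H_t$, an approximation of $\nabla^2 f(w_t)$. The method AINCR takes $x_0\in\mathbb R^n$, $\eta,\beta>0$, $\alpha_0=1$, $\alpha_t\in(0,1)$ for $t\ge1$, a nonnegative nondecreasing sequence $(\bar\mu_t)_{t\ge0}$ and $\lambda\ge0$. With $A_t=\prod_{i=1}^t(1-\alpha_i)$ (so $A_0=1$) and $\ell(z;p)=f(p)+\langle\nabla f(p),z-p\rangle+\frac\lambda2\|z-p\|^2$, it sets $w_0=x_0$, $x_1=\arg\min_z\tilde f_\gamma(z;x_0)$, $\phi_1(z)=f(x_1)+\frac{\bar\mu_0}2\|z-x_0\|^2+\frac\beta6\|z-x_0\|^3$,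 $y_1=\arg\min\phi_1$, and for $t\ge1$ $$w_t=(1-\alpha_t)x_t+\alpha_t y_t,\qquad x_{t+1}=\arg\min_z\tilde f_\eta(z;w_t),$$ $$\phi_{t+1}(z)=\phi_t(z)+\tfrac{\bar\mu_t-\bar\mu_{t-1}}2\|z-x_0\|^2+\tfrac{\alpha_t}{A_t}\ell(z;x_{t+1}),\qquad y_{t+1}=\arg\min\phi_{t+1}.$$ Let $(x_t)$ be generated by AINCR and suppose that for some numbers $0\le\mu_t\le\mu_u$ $$\tfrac{\mu_t}{2}I\preceq H_t-\nabla^2 f(w_t)\preceq\mu_t I\qquad\text{for all }t\ge0 .$$ (a) Let $f$ be strongly convex with parameter $\lambda>0$. For $t\ge1$ put $\bar\lambda_t=\frac\lambda2\left(\frac1{A_{t-1}}-1\right)$ and $$\bar x_t=\arg\min_z\Big\{\tfrac{\bar\mu_{t-1}+\bar\lambda_t}2\|z-y_t\|^2+\tfrac\beta{12}\|z-y_t\|^3+\tfrac{\alpha_t}{A_t}\langle\nabla f(x_{t+1}),z-y_t\rangle\Big\},$$ let $R_t$ satisfy $\|\bar x_t-y_t\|\le R_t$ for all $t\ge1$,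 and let $\bar R>0$ be an upper bound for all $R_t$. If the parameters are $$\alpha_t=\hat\alpha=\min\left\{\tfrac89,\Big[\tfrac{\lambda}{18\sqrt3\,\mu_u}\Big]^{1/2},\tfrac14\Big[\tfrac{\lambda}{\gamma\bar R}\Big]^{1/3}\right\}\ (t\ge1),\quad \bar\mu_t=\tfrac\lambda4\ (t\ge0),\quad\beta=\tfrac{3\lambda}{2\bar R},\quad\eta=4\gamma$$ (the second entry of the minimum being $+\infty$ if $\mu_u=0$), then for every $t\ge1$ $$f(x_t)-f(x_*)\le 2(1-\hat\alpha)^{t-1}\,[f(x_0)-f(x_*)]\left[\frac{2\mu_u\lambda^{-1}+1}{4}+\frac{4\gamma\lambda^{-1}+3\bar R^{-1}}{12}\|x_0-x_*\|\right].$$ (b) Let $f$ be convex and let AINCR be run with $\lambda=0$. If $\alpha_t=\frac3{t+3}$ and $\bar\mu_t=2\mu_u(t+2)$ for all $t\ge0$, $\beta=96\gamma$ and $\eta=4\gamma$, then for every $t\ge1$ $$f(x_t)-f(x_*)\le\frac{98\gamma\|x_0-x_*\|^3}{t(t+1)(t+2)}+\frac{12\mu_u\|x_0-x_*\|^2}{t(t+2)}.$$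 -/

import Mathlib

noncomputable section

namespace AINCR

/-- Euclidean space `ℝⁿ`; continuous linear endomorphisms carry the spectral norm
and the Loewner order `S ≤ T ↔ T - S` is (symmetric) positive semidefinite. -/
abbrev E (n : ℕ) : Type := EuclideanSpace ℝ (Fin n)

variable {n : ℕ}

/-- The Hessian `∇²f(z)` as a linear operator: the derivative of the gradient. -/
def hess (f : E n → ℝ) (z : E n) : E n →L[ℝ] E n :=
  fderiv ℝ (gradient f) z

/-- The cubic-regularized model of `f` at `w` with Hessian approximation `H` and
regularization parameter `η`, evaluated at `z`. -/
def cubicModel (f : E n → ℝ) (H : E n →L[ℝ] E n) (η : ℝ) (w z : E n) : ℝ :=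
  f w + inner ℝ (gradient f w) (z - w) + (1 / 2) * inner ℝ (H (z - w)) (z - w)
    + (η / 6) * ‖z - w‖ ^ 3

/-- The quadratic lower model `ℓ(z; p)` of `f` at `p`. -/
def lowerModel (f : E n → ℝ) (lam : ℝ) (p z : E n) : ℝ :=
  f p + inner ℝ (gradient f p) (z - p) + (lam / 2) * ‖z - p‖ ^ 2

/-- `A_t = ∏_{i=1}^t (1 - α_i)`, with `A_0 = 1`. -/
def A (α : ℕ → ℝ) (t : ℕ) : ℝ := ∏ i ∈ Finset.Icc 1 t, (1 - α i)

/-- The estimate functions `φ_t`, `t ≥ 1`, built from the iterates `x`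
(the value at index `0` is not used). The last clause is
`φ_{s+1} = φ_s + ((μ̄_s - μ̄_{s-1})/2) ‖· - x_0‖² + (α_s / A_s) ℓ(·; x_{s+1})` with `s = t + 1`. -/
def estimateFn (f : E n → ℝ) (lam β : ℝ) (α μbar : ℕ → ℝ) (x : ℕ → E n) : ℕ → E n → ℝ
  | 0 => fun _ => 0
  | 1 => fun z => f (x 1) + (μbar 0 / 2) * ‖z - x 0‖ ^ 2 + (β / 6) * ‖z - x 0‖ ^ 3
  | t + 2 => fun z =>
      estimateFn f lam β α μbar x (t + 1) z
        + ((μbar (t + 1) - μbar t) / 2) * ‖z - x 0‖ ^ 2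
        + (α (t + 1) / A α (t + 1)) * lowerModel f lam (x (t + 2)) z

/-- The sequences `x_t` (`t ≥ 0`), `y_t` (`t ≥ 1`), `w_t` (`t ≥ 0`) are generated by the accelerated
inexact Newton method with cubic regularization, run with Hessian approximations
`H_t` at `w_t`, where `γ` is the cubic parameter of the initial step. -/
structure IsRun (f : E n → ℝ) (γ lam η β : ℝ) (α μbar : ℕ → ℝ)
    (H : ℕ → E n →L[ℝ] E n) (x y w : ℕ → E n) : Prop where
  η_pos : 0 < η
  β_pos : 0 < β
  lam_nonneg : 0 ≤ lam
  α_zero : α 0 = 1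
  α_mem : ∀ t, 1 ≤ t → α t ∈ Set.Ioo (0 : ℝ) 1
  μbar_nonneg : ∀ t, 0 ≤ μbar t
  μbar_mono : Monotone μbar
  w_zero : w 0 = x 0
  x_one : IsMinOn (cubicModel f (H 0) γ (x 0)) Set.univ (x 1)
  y_min : ∀ t, 1 ≤ t → IsMinOn (estimateFn f lam β α μbar x t) Set.univ (y t)
  w_eq : ∀ t, 1 ≤ t → w t = (1 - α t) • x t + α t • y t
  x_succ : ∀ t, 1 ≤ t → IsMinOn (cubicModel f (H t) η (w t)) Set.univ (x (t + 1))

/-- `λ̄_t = (λ/2) (1/A_{t-1} - 1)`, for `t ≥ 1`. -/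
def lamBar (lam : ℝ) (α : ℕ → ℝ) (t : ℕ) : ℝ := (lam / 2) * (1 / A α (t - 1) - 1)

/-- The auxiliary objective whose minimizer is `x̄_t`, for `t ≥ 1`. -/
def auxObjective (f : E n → ℝ) (lam β : ℝ) (α μbar : ℕ → ℝ) (x y : ℕ → E n)
    (t : ℕ) (z : E n) : ℝ :=
  ((μbar (t - 1) + lamBar lam α t) / 2) * ‖z - y t‖ ^ 2 + (β / 12) * ‖z - y t‖ ^ 3
    + (α t / A α t) * inner ℝ (gradient f (x (t + 1))) (z - y t)

/-- `α̂ = min {8/9, (λ/(18√3 μ_u))^{1/2}, (1/4) (λ/(γ R̄))^{1/3}}`, where the second entry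
is `+∞`, hence omitted, if `μ_u = 0`. -/
def alphaHat (lam γ μu Rbar : ℝ) : ℝ :=
  if μu = 0 then
    min (8 / 9) ((1 / 4) * (lam / (γ * Rbar)) ^ (1 / 3 : ℝ))
  else
    min (8 / 9) (min (Real.sqrt (lam / (18 * Real.sqrt 3 * μu)))
      ((1 / 4) * (lam / (γ * Rbar)) ^ (1 / 3 : ℝ)))

end AINCR

end

/-! The proof is an estimate-sequence argument: f(x_{t+1})/A_t ≤ φ_{t+1}(z) ≤ f(z)/A_t plus a fixed
quadratic and cubic penalty in ‖z - x₀‖. Multiplying by A_t at z = x_* makes A_t the convergence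
rate. The upper bound (`estimateFn_le`) holds because each φ adds lower models of f with telescoping
weights α_t/A_t = 1/A_t - 1/A_{t-1}; its start is the first cubic step, `le_of_isMinOn_cubicModel`.
The lower bound (`div_A_le_estimateFn`) is an induction. By `growth_of_isMinOn_cubic`, φ grows at
least quadratically plus cubically away from its minimizer y_t, and this growth must absorb the
linear term (α_t/A_t)⟨g, z - y_t⟩, where g = ∇f(x_{t+1}). What pays for the rest is ⟨g, w_t -
x_{t+1}⟩. Stationarity of the cubic step makes g nearly antiparallel to the step, so for all u ≥ 0,
‖g‖u ≤ ⟨g, w_t - x_{t+1}⟩ + (3/8)μu² + (8/9)γu³ (`norm_gradient_mul_le_of_isMinOn`). Taking u =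
α_t‖z - y_t‖ leaves a scalar inequality between parameters, which is the only place where the two
cases differ substantially. -/

namespace AINCR

/-! ### Cubically regularized quadratics and operator bounds in inner product spaces. -/

section InnerProductSpace

variable {V : Type*} [NormedAddCommGroup V] [InnerProductSpace ℝ V]

/-- Uniform convexity of the cube of the norm, in terms of the side lengths of a triangle. -/
theorem cube_le_of_triangle {p r d : ℝ} (hr : 0 ≤ r) (h1 : p - r ≤ d)
    (h2 : r - p ≤ d) (h3 : d ≤ p + r) (hp : 0 ≤ p) :
    d ^ 3 ≤ 2 * p ^ 3 + r ^ 3 - 3 * r * p ^ 2 + 3 * r * d ^ 2 := by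
  have hd : 0 ≤ d := by linarith
  rcases le_total d (2 * r) with h | h
  -- Since 2p³ - 3rp² + r³ = (p - r)²(2p + r), replacing d² by (p - r)² in d²(3r - d) leaves a
  -- nonnegative multiple of (p - r)².
  · have hsq : (p - r) ^ 2 ≤ d ^ 2 := sq_le_sq' (by linarith) (by linarith)
    have : (p - r) ^ 2 * (3 * r - d) ≤ d ^ 2 * (3 * r - d) :=
      mul_le_mul_of_nonneg_right hsq (by linarith)
    have h4 : 0 ≤ (p - r) ^ 2 * (p + r + r - d) := mul_nonneg (sq_nonneg _) (by linarith)
    have h5 : 0 ≤ (p - r) ^ 2 * p := mul_nonneg (sq_nonneg _) hp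
    have h6 : 0 ≤ (p - r) ^ 2 * r := mul_nonneg (sq_nonneg _) hr
    nlinarith
  -- For d ≥ 2r the function d²(3r - d) decreases, so the worst case is d = p + r, where the gap is
  -- p(p - 3r/2)² + (3/4)pr² + 3r³.
  · have hP : 0 ≤ p + r - d := by linarith
    have h4 : 0 ≤ (p + r - d) * ((p + r) * (p + r - 2 * r)) :=
      mul_nonneg hP (mul_nonneg (by linarith) (by linarith))
    have h5 : 0 ≤ (p + r - d) * (d * (d - 2 * r)) :=
      mul_nonneg hP (mul_nonneg (by linarith) (by linarith))
    have h6 : 0 ≤ (p + r - d) * ((p + r) * (d - 2 * r)) :=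
      mul_nonneg hP (mul_nonneg (by linarith) (by linarith))
    have h7 : 0 ≤ (p + r - d) * (d * (p + r - 2 * r)) :=
      mul_nonneg hP (mul_nonneg (by linarith) (by linarith))
    have h8 : 0 ≤ p * (p - 3 / 2 * r) ^ 2 := mul_nonneg hp (sq_nonneg _)
    have h9 : 0 ≤ p * r ^ 2 := by positivity
    have h10 : 0 ≤ r ^ 3 := by positivity
    linarith

/-- The inner product is determined by the three side lengths, so this is `cube_le_of_triangle`
after polarization. The constant 1/2 becomes β/12 in the growth of φ_t. -/
theorem norm_cube_uniformConvex (y z : V) :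
    ‖y‖ ^ 3 + 3 * ‖y‖ * inner ℝ y (z - y) + 1 / 2 * ‖z - y‖ ^ 3 ≤ ‖z‖ ^ 3 := by
  have h := cube_le_of_triangle (p := ‖z‖) (r := ‖y‖) (d := ‖z - y‖) (norm_nonneg _)
    (norm_sub_norm_le _ _) (by rw [norm_sub_rev]; exact norm_sub_norm_le _ _)
    (norm_sub_le _ _) (norm_nonneg _)
  have e : ‖z‖ ^ 2 = ‖y‖ ^ 2 + 2 * inner ℝ y (z - y) + ‖z - y‖ ^ 2 := by
    rw [← norm_add_sq_real]; simp
  have e2 : 3 * ‖y‖ * ‖z‖ ^ 2 = 3 * ‖y‖ * (‖y‖ ^ 2 + 2 * inner ℝ y (z - y) + ‖z - y‖ ^ 2) := by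
    rw [e]
  nlinarith

theorem hasFDerivAt_norm_cube (s : V) :
    HasFDerivAt (fun z : V => ‖z‖ ^ 3) ((3 * ‖s‖) • innerSL ℝ s) s := by
  have h := hasFDerivAt_norm_rpow s (p := 3) (by norm_num)
  norm_num at h
  convert h using 2

/-- First-order optimality condition for a cubically regularized quadratic. -/
theorem stationary_of_isMinOn_cubic {a : V} {T : V →L[ℝ] V}
    (hT : (T : V →ₗ[ℝ] V).IsSymmetric) {k η : ℝ} {s : V}
    (hs : IsMinOn (fun z => k + inner ℝ a z + (1 / 2) * inner ℝ (T z) z + (η / 6) * ‖z‖ ^ 3)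
      Set.univ s) :
    a + T s + ((η / 2) * ‖s‖) • s = 0 := by
  have h1 : HasFDerivAt (fun z => k + inner ℝ a z + (1 / 2) * inner ℝ (T z) z
      + (η / 6) * ‖z‖ ^ 3) _ s :=
    ((((innerSL ℝ a).hasFDerivAt (x := s)).const_add k).add
      (((T.hasFDerivAt (x := s)).inner ℝ (hasFDerivAt_id s)).const_mul (1 / 2))).add
      ((hasFDerivAt_norm_cube s).const_mul (η / 6))
  have h0 := (hs.isLocalMin Filter.univ_mem).hasFDerivAt_eq_zero h1
  refine ext_inner_right ℝ fun v => ?_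
  have hv := congrArg (fun L : V →L[ℝ] ℝ => L v) h0
  have hsym : inner ℝ (T v) s = inner ℝ (T s) v := by
    rw [real_inner_comm]; exact (hT s v).symm
  simp at hv
  rw [hsym] at hv
  simp only [inner_add_left, inner_smul_left, inner_zero_left]
  simp
  linarith

/-- Growth of a cubically regularized quadratic away from its minimizer. -/
theorem growth_of_isMinOn_cubic {a o y : V} {k κ β : ℝ} (hβ : 0 ≤ β) {φ : V → ℝ}
    (hφ : ∀ z, φ z = k + inner ℝ a (z - o) + (κ / 2) * ‖z - o‖ ^ 2 + (β / 6) * ‖z - o‖ ^ 3)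
    (hy : IsMinOn φ Set.univ y) (z : V) :
    φ y + (κ / 2) * ‖z - y‖ ^ 2 + (β / 12) * ‖z - y‖ ^ 3 ≤ φ z := by
  have hst := stationary_of_isMinOn_cubic (a := a) (T := κ • ContinuousLinearMap.id ℝ V)
    (k := k) (η := β) (s := y - o) (by intro u v; simp [inner_smul_left, inner_smul_right])
    (by
      intro v _
      have := hy (Set.mem_univ (v + o))
      simp only [Set.mem_ofPred_eq, hφ, add_sub_cancel_right] at this ⊢
      simp only [smul_apply, ContinuousLinearMap.id_apply, inner_smul_left,
        real_inner_self_eq_norm_sq]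
      simp only [conj_trivial]
      linarith)
  have hst' := congrArg (fun u => inner ℝ u (z - y)) hst
  simp [inner_add_left, inner_smul_left] at hst'
  have hc := norm_cube_uniformConvex (y - o) (z - o)
  have ez : z - o = (y - o) + (z - y) := by abel
  have ed : z - o - (y - o) = z - y := by abel
  rw [ed] at hc
  have hq : ‖z - o‖ ^ 2 = ‖y - o‖ ^ 2 + 2 * inner ℝ (y - o) (z - y) + ‖z - y‖ ^ 2 := by
    rw [ez, norm_add_sq_real]
  have ha : inner ℝ a (z - o) = inner ℝ a (y - o) + inner ℝ a (z - y) := by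
    rw [ez, inner_add_right]
  rw [hφ, hφ, hq, ha]
  have := mul_le_mul_of_nonneg_left hc (show 0 ≤ β / 6 by positivity)
  linear_combination this - hst'

/-- A symmetric operator `P` with `0 ≤ P ≤ m` satisfies `‖P s‖² ≤ m ⟨P s, s⟩`. -/
theorem norm_sq_apply_le_of_isPositive {P : V →L[ℝ] V} {m : ℝ} (hP : P.IsPositive)
    (hm : 0 ≤ m) (hPm : ∀ v, inner ℝ (P v) v ≤ m * ‖v‖ ^ 2) (s : V) :
    ‖P s‖ ^ 2 ≤ m * inner ℝ (P s) s := by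
  have hpos : ∀ v, 0 ≤ inner ℝ (P v) v := fun v => by
    simpa [ContinuousLinearMap.reApplyInnerSelf] using hP.2 v
  have hsym : inner ℝ (P (P s)) s = ‖P s‖ ^ 2 := by
    rw [← real_inner_self_eq_norm_sq]; exact hP.1 (P s) s
  have key : ∀ τ : ℝ, 0 ≤ inner ℝ (P s) s - 2 * τ * ‖P s‖ ^ 2
      + τ ^ 2 * inner ℝ (P (P s)) (P s) := fun τ => by
    have := hpos (s - τ • P s)
    simp only [map_sub, map_smul, inner_sub_left, inner_sub_right, inner_smul_left,
      inner_smul_right, real_inner_self_eq_norm_sq, hsym] at this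
    simp only [conj_trivial] at this
    linarith
  -- The choice τ = 1/m optimizes the bound once ⟨P(Ps), Ps⟩ ≤ m‖Ps‖² is inserted; for m = 0 the
  -- value τ = 1 already forces Ps = 0.
  rcases hm.eq_or_lt with rfl | hm
  · have := key 1
    have h1 := hPm s
    have h2 := hPm (P s)
    linarith
  · have h1 := key m⁻¹
    have h2 := mul_le_mul_of_nonneg_left (hPm (P s)) (sq_nonneg m⁻¹)
    have h3 : m⁻¹ ^ 2 * (m * ‖P s‖ ^ 2) = m⁻¹ * ‖P s‖ ^ 2 := by field_simp
    have h4 : m⁻¹ * ‖P s‖ ^ 2 ≤ inner ℝ (P s) s := by linarith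
    have h5 := mul_le_mul_of_nonneg_left h4 hm.le
    rwa [mul_inv_cancel_left₀ hm.ne'] at h5

/-- An operator between `μ/2` and `μ` differs from its midpoint `3μ/4` by at most `μ/4`. -/
theorem norm_apply_sub_midpoint_le {B : V →L[ℝ] V} {μ : ℝ} (hμ : 0 ≤ μ)
    (h1 : (μ / 2) • (1 : V →L[ℝ] V) ≤ B) (h2 : B ≤ μ • (1 : V →L[ℝ] V)) (s : V) :
    ‖B s - (3 * μ / 4) • s‖ ≤ μ / 4 * ‖s‖ := by
  rw [ContinuousLinearMap.le_def] at h1 h2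
  have h := norm_sq_apply_le_of_isPositive h1 (show 0 ≤ μ / 2 by positivity) (fun v => by
    have := h2.2 v
    simp [ContinuousLinearMap.reApplyInnerSelf, inner_sub_left, inner_smul_left] at this ⊢
    linarith) s
  have e : B s - (3 * μ / 4) • s = (B - (μ / 2) • (1 : V →L[ℝ] V)) s - (μ / 4) • s := by
    simp only [sub_apply, smul_apply,
      one_apply_eq_self]
    module
  rw [e]
  -- With P = B - μ/2, the bound ‖Ps‖² ≤ (μ/2)⟨Ps, s⟩ is exactly what cancels the cross term of ‖Ps
  -- - (μ/4)s‖².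
  refine le_of_sq_le_sq ?_ (by positivity)
  rw [norm_sub_sq_real, inner_smul_right, norm_smul, Real.norm_eq_abs, mul_pow, sq_abs]
  linarith

end InnerProductSpace

end AINCR
namespace AINCR

/-! ### First-order inequalities along lines. -/

section Calculus

variable {V : Type*} [NormedAddCommGroup V] [InnerProductSpace ℝ V]

theorem hasDerivAt_add_smul (w s : V) (t : ℝ) : HasDerivAt (fun τ : ℝ => w + τ • s) s t := by
  simpa using ((hasDerivAt_id t).smul_const s).const_add w

theorem hasDerivAt_line [CompleteSpace V] {f : V → ℝ} (hf : Differentiable ℝ f) (w s : V) (t : ℝ) :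
    HasDerivAt (fun τ : ℝ => f (w + τ • s)) (inner ℝ (gradient f (w + t • s)) s) t := by
  have h := ((hf (w + t • s)).hasGradientAt.hasFDerivAt).comp_hasDerivAt t
    (hasDerivAt_add_smul w s t)
  rw [InnerProductSpace.toDual_apply_apply] at h
  exact h

/-- The first-order lower bound for a strongly convex function. -/
theorem gradient_inequality [CompleteSpace V] {f : V → ℝ} {lam : ℝ} (hf : Differentiable ℝ f)
    (hc : StrongConvexOn Set.univ lam f) (p z : V) :
    f p + inner ℝ (gradient f p) (z - p) + (lam / 2) * ‖z - p‖ ^ 2 ≤ f z := by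
  have hc' := strongConvexOn_iff_convex.1 hc
  have hline : ConvexOn ℝ Set.univ
      ((fun x => f x - lam / 2 * ‖x‖ ^ 2) ∘ (AffineMap.lineMap p z : ℝ →ᵃ[ℝ] V)) := by
    simpa using hc'.comp_affineMap (AffineMap.lineMap p z : ℝ →ᵃ[ℝ] V)
  have hfun : ((fun x => f x - lam / 2 * ‖x‖ ^ 2) ∘ (AffineMap.lineMap p z : ℝ →ᵃ[ℝ] V))
      = fun τ : ℝ => f (p + τ • (z - p)) - lam / 2 * ‖p + τ • (z - p)‖ ^ 2 := by
    funext τ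
    simp [AffineMap.lineMap_apply, add_comm]
  rw [hfun] at hline
  have hd := (hasDerivAt_line hf p (z - p) 0).fun_sub
    (((hasDerivAt_add_smul p (z - p) 0).norm_sq).const_mul (lam / 2))
  have hs := hline.le_slope_of_hasDerivAt (Set.mem_univ 0) (Set.mem_univ 1) one_pos hd
  have hz : ‖z‖ ^ 2 = ‖p‖ ^ 2 + 2 * inner ℝ p (z - p) + ‖z - p‖ ^ 2 := by
    rw [← norm_add_sq_real]; simp
  simp only [slope_def_field, zero_smul, add_zero, one_smul, add_sub_cancel, sub_zero, div_one,
    hz] at hs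
  linarith

end Calculus

/-! ### Symmetry of the Hessian and Taylor bounds. -/

variable {n : ℕ}

theorem differentiable_gradient {f : E n → ℝ} (hf : ContDiff ℝ 2 f) :
    Differentiable ℝ (gradient f) := by
  have h : Differentiable ℝ (fderiv ℝ f) :=
    (hf.fderiv_right (m := 1) (by norm_num)).differentiable (by norm_num)
  exact ((InnerProductSpace.toDual ℝ (E n)).symm.toContinuousLinearEquiv.differentiable).comp h

theorem inner_hess {f : E n → ℝ} (hf : ContDiff ℝ 2 f) (z u v : E n) :
    inner ℝ (hess f z u) v = fderiv ℝ (fderiv ℝ f) z u v := by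
  have h : Differentiable ℝ (fderiv ℝ f) :=
    (hf.fderiv_right (m := 1) (by norm_num)).differentiable (by norm_num)
  have h2 : HasFDerivAt (gradient f) _ z :=
    ((InnerProductSpace.toDual ℝ (E n)).symm.toContinuousLinearEquiv.hasFDerivAt).comp z
      (h z).hasFDerivAt
  rw [hess, h2.fderiv]
  simp

theorem hess_isSymmetric {f : E n → ℝ} (hf : ContDiff ℝ 2 f) (z : E n) :
    (hess f z : E n →ₗ[ℝ] E n).IsSymmetric := by
  intro u v
  have h := (hf.contDiffAt (x := z)).isSymmSndFDerivAt (by simp)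
  change inner ℝ (hess f z u) v = inner ℝ u (hess f z v)
  rw [real_inner_comm (hess f z v), inner_hess hf, inner_hess hf]
  exact h u v

/-- Second-order Taylor bound for the gradient along a segment. -/
theorem norm_gradient_taylor_le {f : E n → ℝ} (hf : ContDiff ℝ 2 f) {γ : ℝ}
    (hLip : ∀ z z' : E n, ‖hess f z - hess f z'‖ ≤ γ * ‖z - z'‖) (w s : E n) {t : ℝ}
    (ht : 0 ≤ t) :
    ‖gradient f (w + t • s) - gradient f w - t • hess f w s‖ ≤ γ / 2 * t ^ 2 * ‖s‖ ^ 2 := by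
  have hd : ∀ τ : ℝ, HasDerivAt (fun τ : ℝ => gradient f (w + τ • s) - gradient f w
      - τ • hess f w s) (hess f (w + τ • s) s - hess f w s) τ := fun τ => by
    have h1 := ((differentiable_gradient hf (w + τ • s)).hasFDerivAt).comp_hasDerivAt τ
      (hasDerivAt_add_smul w s τ)
    have h2 := (h1.sub_const (gradient f w)).fun_sub ((hasDerivAt_id τ).smul_const (hess f w s))
    simpa [hess] using h2
  have hB : ∀ τ : ℝ, HasDerivAt (fun τ : ℝ => γ / 2 * τ ^ 2 * ‖s‖ ^ 2) (γ * τ * ‖s‖ ^ 2) τ :=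
    fun τ => by
      exact (((hasDerivAt_pow 2 τ).const_mul (γ / 2)).mul_const (‖s‖ ^ 2)).congr_deriv
        (by push_cast; ring)
  -- Comparing derivatives in τ replaces the integral remainder: both sides vanish at 0, and the
  -- Lipschitz Hessian bounds the derivative by γτ‖s‖².
  refine image_norm_le_of_norm_deriv_right_le_deriv_boundary (a := 0) (b := t)
    (fun τ _ => (hd τ).continuousAt.continuousWithinAt) (fun τ _ => (hd τ).hasDerivWithinAt)
    (by simp) hB (fun τ hτ => ?_) (Set.right_mem_Icc.2 ht)
  rw [← sub_apply]
  refine (ContinuousLinearMap.le_opNorm _ _).trans ?_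
  have h := mul_le_mul_of_nonneg_right (hLip (w + τ • s) w) (norm_nonneg s)
  rw [add_sub_cancel_left, norm_smul, Real.norm_eq_abs, abs_of_nonneg hτ.1] at h
  linarith

/-- Third-order Taylor bound for a function with Lipschitz Hessian. -/
theorem abs_taylor_le {f : E n → ℝ} (hf : ContDiff ℝ 2 f) {γ : ℝ}
    (hLip : ∀ z z' : E n, ‖hess f z - hess f z'‖ ≤ γ * ‖z - z'‖) (w s : E n) :
    |f (w + s) - f w - inner ℝ (gradient f w) s - (1 / 2) * inner ℝ (hess f w s) s|
      ≤ γ / 6 * ‖s‖ ^ 3 := by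
  have hd : ∀ τ : ℝ, HasDerivAt (fun τ : ℝ => f (w + τ • s) - f w
      - τ * inner ℝ (gradient f w) s - τ ^ 2 / 2 * inner ℝ (hess f w s) s)
      (inner ℝ (gradient f (w + τ • s) - gradient f w - τ • hess f w s) s) τ := fun τ => by
    have h1 := hasDerivAt_line (hf.differentiable (by norm_num)) w s τ
    have h2 := ((h1.sub_const (f w)).fun_sub
      ((hasDerivAt_id τ).mul_const (inner ℝ (gradient f w) s))).fun_sub
      (((hasDerivAt_pow 2 τ).div_const 2).mul_const (inner ℝ (hess f w s) s))
    exact h2.congr_deriv (by simp [inner_sub_left, inner_smul_left])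
  have hB : ∀ τ : ℝ, HasDerivAt (fun τ : ℝ => γ / 6 * τ ^ 3 * ‖s‖ ^ 3)
      (γ / 2 * τ ^ 2 * ‖s‖ ^ 3) τ := fun τ => by
    exact (((hasDerivAt_pow 3 τ).const_mul (γ / 6)).mul_const (‖s‖ ^ 3)).congr_deriv
      (by push_cast; ring)
  have := image_norm_le_of_norm_deriv_right_le_deriv_boundary (a := 0) (b := 1)
    (fun τ _ => (hd τ).continuousAt.continuousWithinAt) (fun τ _ => (hd τ).hasDerivWithinAt)
    (by simp) hB (fun τ hτ => by
      refine (norm_inner_le_norm _ _).trans ?_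
      have h := mul_le_mul_of_nonneg_right
        (norm_gradient_taylor_le hf hLip w s hτ.1) (norm_nonneg s)
      linarith) (Set.right_mem_Icc.2 zero_le_one)
  simpa using this

end AINCR
namespace AINCR

variable {n : ℕ}

/-! ### The inexact cubic Newton step. -/

section CubicStep

/-- Scalar core of the alignment estimate: G = ‖g‖, r = ‖s‖, D = -⟨g, s⟩, and the hypothesis is ‖g +
cs‖² ≤ d²r². As d ≤ c/3, it yields 2cD ≥ G² + (8/9)c²r²; then 2cGu ≤ G² + c²u² brings in u, and
Young's inequality for ru² removes r. -/
theorem mul_le_of_sq_le {G D r μ γ u c d : ℝ} (hr : 0 ≤ r) (hμ : 0 ≤ μ) (hγ : 0 ≤ γ)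
    (hu : 0 ≤ u) (hc : c = 3 * μ / 4 + 2 * γ * r) (hd : d = μ / 4 + γ / 2 * r)
    (hc0 : 0 < c) (h : G ^ 2 - 2 * c * D + c ^ 2 * r ^ 2 ≤ d ^ 2 * r ^ 2) :
    G * u ≤ D + 3 / 8 * μ * u ^ 2 + 8 / 9 * γ * u ^ 3 := by
  have hγr : 0 ≤ γ * r := mul_nonneg hγ hr
  have hd0 : 0 ≤ d := by rw [hd]; linarith
  have hdc : d ^ 2 ≤ (c / 3) ^ 2 := pow_le_pow_left₀ hd0 (by rw [hc, hd]; linarith) 2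
  have h1 : d ^ 2 * r ^ 2 ≤ (c / 3) ^ 2 * r ^ 2 := mul_le_mul_of_nonneg_right hdc (sq_nonneg r)
  have hcub : 0 ≤ (r + 2 * u) * (r - u) ^ 2 := mul_nonneg (by linarith) (sq_nonneg _)
  have hr3 : 0 ≤ r ^ 3 := by positivity
  have hu3 : 0 ≤ u ^ 3 := by positivity
  have h2 : γ * (r * u ^ 2) ≤ γ * (8 / 9 * r ^ 3 + 8 / 9 * u ^ 3) :=
    mul_le_mul_of_nonneg_left (by linarith) hγ
  have h3 : c * u ^ 2 ≤ 8 / 9 * c * r ^ 2 + 3 / 4 * μ * u ^ 2 + 16 / 9 * γ * u ^ 3 := by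
    have : 0 ≤ μ * r ^ 2 := by positivity
    rw [hc]; linarith
  have h4 := mul_le_mul_of_nonneg_left h3 hc0.le
  have h5 : 0 ≤ (G - c * u) ^ 2 := sq_nonneg _
  refine le_of_mul_le_mul_left ?_ (show 0 < 2 * c by linarith)
  linarith

variable {f : E n → ℝ} {γ : ℝ} {H : E n →L[ℝ] E n} {w p : E n} {μ : ℝ}

/-- The Loewner order contains the symmetry of the difference, and the Hessian is symmetric, so
symmetry of H need not be assumed. -/
theorem isSymmetric_of_hess_add_le (hf : ContDiff ℝ 2 f)
    (h1 : (μ / 2) • (1 : E n →L[ℝ] E n) ≤ H - hess f w) : (H : E n →ₗ[ℝ] E n).IsSymmetric := by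
  rw [ContinuousLinearMap.le_def] at h1
  intro u v
  have e1 := h1.1 u v
  have e2 := hess_isSymmetric hf w u v
  simp [inner_sub_left, inner_sub_right, inner_smul_left, inner_smul_right] at e1 e2 ⊢
  linarith

/-- The inexact cubic step makes the gradient at the new point well aligned with the step. -/
theorem norm_gradient_mul_le_of_isMinOn (hf : ContDiff ℝ 2 f) (hγ : 0 < γ)
    (hLip : ∀ z z' : E n, ‖hess f z - hess f z'‖ ≤ γ * ‖z - z'‖) (hμ : 0 ≤ μ)
    (h1 : (μ / 2) • (1 : E n →L[ℝ] E n) ≤ H - hess f w)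
    (h2 : H - hess f w ≤ μ • (1 : E n →L[ℝ] E n))
    (hp : IsMinOn (cubicModel f H (4 * γ) w) Set.univ p) {u : ℝ} (hu : 0 ≤ u) :
    ‖gradient f p‖ * u ≤
      inner ℝ (gradient f p) (w - p) + 3 / 8 * μ * u ^ 2 + 8 / 9 * γ * u ^ 3 := by
  set s := p - w with hs
  set g := gradient f p with hg
  have hst := stationary_of_isMinOn_cubic (a := gradient f w) (T := H) (k := f w) (η := 4 * γ)
    (s := s) (isSymmetric_of_hess_add_le hf h1) (by
      intro v _
      have := hp (Set.mem_univ (w + v))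
      simpa only [Set.mem_ofPred_eq, cubicModel, add_sub_cancel_left, ← hs] using this)
  have ht := norm_gradient_taylor_le hf hLip w s zero_le_one
  have hmid := norm_apply_sub_midpoint_le hμ h1 h2 s
  have hps : w + (1 : ℝ) • s = p := by rw [hs]; simp
  rw [hps, one_smul, ← hg] at ht
  have hgc : ‖g + (3 * μ / 4 + 2 * γ * ‖s‖) • s‖ ≤ (μ / 4 + γ / 2 * ‖s‖) * ‖s‖ := by
    -- By stationarity, what remains is the Taylor error of the gradient minus the deviation of H -
    -- ∇²f(w) from its midpoint 3μ/4; the term 2γ‖s‖ is η/2 · ‖s‖ with η = 4γ.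
    have e : g + (3 * μ / 4 + 2 * γ * ‖s‖) • s
        = (g - gradient f w - hess f w s) - ((H - hess f w) s - (3 * μ / 4) • s) := by
      have : g + (3 * μ / 4 + 2 * γ * ‖s‖) • s
          = (g - gradient f w - hess f w s) - ((H - hess f w) s - (3 * μ / 4) • s)
            + (gradient f w + H s + (4 * γ / 2 * ‖s‖) • s) := by
        simp only [sub_apply]
        module
      rw [this, hst, add_zero]
    rw [e]
    refine (norm_sub_le _ _).trans ((add_le_add ht hmid).trans (le_of_eq ?_))
    ring
  have hD : inner ℝ g (w - p) = -inner ℝ g s := by rw [← inner_neg_right, hs]; simp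
  rw [hD]
  have hc0 : 0 ≤ 3 * μ / 4 + 2 * γ * ‖s‖ := by positivity
  -- If the coefficient vanishes, then so do μ and γ‖s‖, hence g = 0; otherwise it can be divided
  -- out.
  rcases hc0.eq_or_lt with hc | hc
  · have hγs : 0 ≤ γ * ‖s‖ := by positivity
    have hμ0 : μ = 0 := by linarith
    have hγ0 : γ * ‖s‖ = 0 := by linarith
    have hg0 : g = 0 := by
      rw [← hc, zero_smul, add_zero] at hgc
      have : (μ / 4 + γ / 2 * ‖s‖) = 0 := by linarith
      rw [this, zero_mul] at hgc
      exact norm_le_zero_iff.1 hgc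
    rw [hg0, hμ0]
    simp only [norm_zero, zero_mul, inner_zero_left]
    positivity
  · refine mul_le_of_sq_le (norm_nonneg s) hμ hγ.le hu rfl rfl hc ?_
    have hsq := pow_le_pow_left₀ (norm_nonneg _) hgc 2
    rw [norm_add_sq_real, inner_smul_right, norm_smul, Real.norm_eq_abs, mul_pow, sq_abs] at hsq
    linarith

/-- The value at a minimizer of the cubic model is controlled by every competitor. -/
theorem le_of_isMinOn_cubicModel (hf : ContDiff ℝ 2 f)
    (hLip : ∀ z z' : E n, ‖hess f z - hess f z'‖ ≤ γ * ‖z - z'‖) (hμ : 0 ≤ μ)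
    (h1 : (μ / 2) • (1 : E n →L[ℝ] E n) ≤ H - hess f w)
    (h2 : H - hess f w ≤ μ • (1 : E n →L[ℝ] E n))
    (hp : IsMinOn (cubicModel f H γ w) Set.univ p) (z : E n) :
    f p ≤ f z + μ / 2 * ‖z - w‖ ^ 2 + γ / 3 * ‖z - w‖ ^ 3 := by
  rw [ContinuousLinearMap.le_def] at h1 h2
  have hmin := hp (Set.mem_univ z)
  simp only [Set.mem_ofPred_eq, cubicModel] at hmin
  have e1 := (abs_le.1 (abs_taylor_le hf hLip w (p - w))).2
  have e2 := (abs_le.1 (abs_taylor_le hf hLip w (z - w))).1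
  -- Since H dominates the Hessian, the model majorizes f at p; at z it exceeds f by at most the
  -- matrix error plus twice the Taylor error γ/6.
  have l1 : ∀ v, 0 ≤ inner ℝ (H v) v - inner ℝ (hess f w v) v - μ / 2 * ‖v‖ ^ 2 := fun v => by
    simpa [ContinuousLinearMap.reApplyInnerSelf, inner_sub_left, inner_smul_left] using h1.2 v
  have l2 : ∀ v, inner ℝ (H v) v - inner ℝ (hess f w v) v ≤ μ * ‖v‖ ^ 2 := fun v => by
    simpa [ContinuousLinearMap.reApplyInnerSelf, inner_sub_left, inner_smul_left] using h2.2 v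
  have l1 := l1 (p - w)
  have l2 := l2 (z - w)
  rw [add_sub_cancel] at e1 e2
  have : 0 ≤ μ / 2 * ‖p - w‖ ^ 2 := by positivity
  linarith

end CubicStep

/-! ### Two-sided bounds for the estimate functions. -/

section EstimateSequence

theorem A_zero (α : ℕ → ℝ) : A α 0 = 1 := by simp [A]

theorem A_succ (α : ℕ → ℝ) (t : ℕ) : A α (t + 1) = A α t * (1 - α (t + 1)) := by
  rw [A, A, Finset.prod_Icc_succ_top (by omega)]

theorem A_pos {α : ℕ → ℝ} (hα : ∀ t, 1 ≤ t → α t ∈ Set.Ioo (0 : ℝ) 1) (t : ℕ) : 0 < A α t :=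
  Finset.prod_pos fun i hi => by
    have := (hα i (Finset.mem_Icc.1 hi).1).2
    linarith

/-- The weights telescope, so the lower models accumulated in φ_{t+1} have total weight 1/A_t - 1.
-/
theorem div_A_succ {α : ℕ → ℝ} (hα : ∀ t, 1 ≤ t → α t ∈ Set.Ioo (0 : ℝ) 1) (t : ℕ) :
    α (t + 1) / A α (t + 1) = 1 / A α (t + 1) - 1 / A α t := by
  have h0 := (A_pos hα t).ne'
  have h1 : 1 - α (t + 1) ≠ 0 := by
    have := (hα (t + 1) (by omega)).2
    linarith
  rw [A_succ]
  field_simp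
  ring

variable {f : E n → ℝ} {lam β : ℝ} {α μbar : ℕ → ℝ} {x : ℕ → E n}

theorem lowerModel_expand (f : E n → ℝ) (lam : ℝ) (p o z : E n) :
    lowerModel f lam p z = f p + inner ℝ (gradient f p) (o - p) + lam / 2 * ‖o - p‖ ^ 2
      + inner ℝ (gradient f p + lam • (o - p)) (z - o) + lam / 2 * ‖z - o‖ ^ 2 := by
  have e : z - p = (o - p) + (z - o) := by abel
  rw [lowerModel, e, norm_add_sq_real, inner_add_right, inner_add_left, inner_smul_left]
  simp only [conj_trivial]
  ring

theorem estimateFn_succ_succ (f : E n → ℝ) (lam β : ℝ) (α μbar : ℕ → ℝ) (x : ℕ → E n) (t : ℕ)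
    (z : E n) : estimateFn f lam β α μbar x (t + 2) z = estimateFn f lam β α μbar x (t + 1) z
      + ((μbar (t + 1) - μbar t) / 2) * ‖z - x 0‖ ^ 2
      + (α (t + 1) / A α (t + 1)) * lowerModel f lam (x (t + 2)) z := rfl

/-- The estimate functions are cubically regularized quadratics centred at `x₀`. -/
theorem estimateFn_eq_cubic (hα : ∀ t, 1 ≤ t → α t ∈ Set.Ioo (0 : ℝ) 1) (t : ℕ) :
    ∃ (k : ℝ) (a : E n), ∀ z, estimateFn f lam β α μbar x (t + 1) z =
      k + inner ℝ a (z - x 0) + ((μbar t + lam * (1 / A α t - 1)) / 2) * ‖z - x 0‖ ^ 2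
        + (β / 6) * ‖z - x 0‖ ^ 3 := by
  induction t with
  | zero => exact ⟨f (x 1), 0, fun z => by simp [estimateFn, A_zero]⟩
  | succ t ih =>
    obtain ⟨k, a, h⟩ := ih
    set p := x (t + 2)
    set q := α (t + 1) / A α (t + 1) with hq
    refine ⟨k + q * (f p + inner ℝ (gradient f p) (x 0 - p) + lam / 2 * ‖x 0 - p‖ ^ 2),
      a + q • (gradient f p + lam • (x 0 - p)), fun z => ?_⟩
    rw [estimateFn_succ_succ, h, lowerModel_expand f lam _ (x 0), ← hq, inner_add_left _ (q • _),
      inner_smul_left]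
    have hqA : q = 1 / A α (t + 1) - 1 / A α t := div_A_succ hα t
    have : 1 / A α (t + 1) = q + 1 / A α t := by rw [hqA]; ring
    rw [this]
    simp only [conj_trivial]
    ring

/-- The initial f(x₁) costs f(z) + C, and the lower models contribute at most (1/A_t - 1)f(z) in
total. -/
theorem estimateFn_le (hα : ∀ t, 1 ≤ t → α t ∈ Set.Ioo (0 : ℝ) 1) {z : E n} {C : ℝ}
    (h0 : f (x 1) ≤ f z + C) (hl : ∀ p, lowerModel f lam p z ≤ f z) (t : ℕ) :
    estimateFn f lam β α μbar x (t + 1) z ≤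
      f z / A α t + C + μbar t / 2 * ‖z - x 0‖ ^ 2 + β / 6 * ‖z - x 0‖ ^ 3 := by
  induction t with
  | zero => simp only [estimateFn, A_zero]; linarith
  | succ t ih =>
    have hq := div_A_succ hα t
    have hq0 : 0 ≤ α (t + 1) / A α (t + 1) :=
      div_nonneg (hα (t + 1) (by omega)).1.le (A_pos hα _).le
    have hm := mul_le_mul_of_nonneg_left (hl (x (t + 2))) hq0
    have e : α (t + 1) / A α (t + 1) * f z = f z / A α (t + 1) - f z / A α t := by
      rw [hq]; ring
    rw [estimateFn_succ_succ]
    linarith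

variable {y w : ℕ → E n} {γ η : ℝ} {H : ℕ → E n →L[ℝ] E n}

/-- The minimal values of the estimate functions dominate the scaled function values. -/
theorem div_A_le_estimateFn (hrun : IsRun f γ lam η β α μbar H x y w)
    (hl : ∀ p z, lowerModel f lam p z ≤ f z)
    (hstep : ∀ (t : ℕ) (z : E n), 0 ≤
      1 / A α (t + 1) * inner ℝ (gradient f (x (t + 2))) (w (t + 1) - x (t + 2))
      + α (t + 1) / A α (t + 1) * inner ℝ (gradient f (x (t + 2))) (z - y (t + 1))
      + (μbar t + lam * (1 / A α t - 1)) / 2 * ‖z - y (t + 1)‖ ^ 2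
      + β / 12 * ‖z - y (t + 1)‖ ^ 3) (t : ℕ) (z : E n) :
    f (x (t + 1)) / A α t ≤ estimateFn f lam β α μbar x (t + 1) z := by
  induction t generalizing z with
  | zero =>
    have := hrun.μbar_nonneg 0
    have := hrun.β_pos
    have h1 : 0 ≤ μbar 0 / 2 * ‖z - x 0‖ ^ 2 := by positivity
    have h2 : 0 ≤ β / 6 * ‖z - x 0‖ ^ 3 := by positivity
    simp only [estimateFn, A_zero, div_one, zero_add]
    linarith
  | succ t ih =>
    obtain ⟨k, a, hform⟩ := estimateFn_eq_cubic (f := f) (lam := lam) (β := β) (μbar := μbar)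
      (x := x) hrun.α_mem t
    have hgrow := growth_of_isMinOn_cubic hrun.β_pos.le hform
      (hrun.y_min (t + 1) (by omega)) z
    have hy := ih (y (t + 1))
    have hs := hstep t z
    have hq := div_A_succ hrun.α_mem t
    set g := gradient f (x (t + 2)) with hg
    have hα := hrun.α_mem (t + 1) (by omega)
    have hA := A_pos hrun.α_mem t
    have hA1 := A_pos hrun.α_mem (t + 1)
    have hmu : 0 ≤ (μbar (t + 1) - μbar t) / 2 * ‖z - x 0‖ ^ 2 :=
      mul_nonneg (by have := hrun.μbar_mono (Nat.le_succ t); simp at this; linarith) (sq_nonneg _)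
    have hxt := hl (x (t + 2)) (x (t + 1))
    rw [lowerModel, ← hg] at hxt
    have hlam := hrun.lam_nonneg
    have h1 : 0 ≤ lam / 2 * ‖x (t + 1) - x (t + 2)‖ ^ 2 := by positivity
    have hq0 : 0 ≤ α (t + 1) / A α (t + 1) := div_nonneg hα.1.le hA1.le
    have h2 : 0 ≤ α (t + 1) / A α (t + 1) * (lam / 2 * ‖z - x (t + 2)‖ ^ 2) := by positivity
    -- Linearizing the old value f(x_{t+1}) at the new point produces the x-part of w_{t+1}; the
    -- lower model in φ_{t+2} produces the y-part. Together they form ⟨g, w_{t+1} -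
    -- x_{t+2}⟩/A_{t+1}, as `hstep` requires.
    have hxt' : (f (x (t + 2)) + inner ℝ g (x (t + 1) - x (t + 2))) / A α t
        ≤ f (x (t + 1)) / A α t := by
      gcongr
      linarith
    have hw : inner ℝ g (w (t + 1) - x (t + 2))
        = (1 - α (t + 1)) * inner ℝ g (x (t + 1) - x (t + 2))
          + α (t + 1) * inner ℝ g (y (t + 1) - x (t + 2)) := by
      rw [hrun.w_eq (t + 1) (by omega), ← inner_smul_right, ← inner_smul_right, ← inner_add_right]
      congr 1
      module
    have hz : inner ℝ g (z - x (t + 2))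
        = inner ℝ g (z - y (t + 1)) + inner ℝ g (y (t + 1) - x (t + 2)) := by
      rw [← inner_add_right]; congr 1; abel
    have e1 : 1 / A α (t + 1) * (1 - α (t + 1)) = 1 / A α t := by
      rw [mul_sub, mul_one, one_div_mul_eq_div, hq]; ring
    rw [estimateFn_succ_succ, lowerModel, ← hg, hz]
    rw [hw] at hs
    have e2 : 1 / A α (t + 1) * ((1 - α (t + 1)) * inner ℝ g (x (t + 1) - x (t + 2))
          + α (t + 1) * inner ℝ g (y (t + 1) - x (t + 2)))
        = 1 / A α t * inner ℝ g (x (t + 1) - x (t + 2))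
          + α (t + 1) / A α (t + 1) * inner ℝ g (y (t + 1) - x (t + 2)) := by
      rw [← e1]; ring
    rw [e2] at hs
    have e3 : α (t + 1) / A α (t + 1) * f (x (t + 2))
        = f (x (t + 2)) / A α (t + 1) - f (x (t + 2)) / A α t := by rw [hq]; ring
    have e4 : (f (x (t + 2)) + inner ℝ g (x (t + 1) - x (t + 2))) / A α t
        = f (x (t + 2)) / A α t + 1 / A α t * inner ℝ g (x (t + 1) - x (t + 2)) := by ring
    rw [e4] at hxt'
    linarith

/-- The convergence estimate of the method, given that each step is compatible with the
estimate functions. -/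
theorem sub_le_of_isRun (hf : ContDiff ℝ 2 f)
    (hLip : ∀ z z' : E n, ‖hess f z - hess f z'‖ ≤ γ * ‖z - z'‖)
    (hrun : IsRun f γ lam η β α μbar H x y w) {μ : ℕ → ℝ} {μu : ℝ}
    (hμ : ∀ t, 0 ≤ μ t ∧ μ t ≤ μu)
    (hH : ∀ t, (μ t / 2) • (1 : E n →L[ℝ] E n) ≤ H t - hess f (w t) ∧
      H t - hess f (w t) ≤ μ t • (1 : E n →L[ℝ] E n))
    (hconv : StrongConvexOn Set.univ lam f)
    (hstep : ∀ (t : ℕ) (z : E n), 0 ≤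
      1 / A α (t + 1) * inner ℝ (gradient f (x (t + 2))) (w (t + 1) - x (t + 2))
      + α (t + 1) / A α (t + 1) * inner ℝ (gradient f (x (t + 2))) (z - y (t + 1))
      + (μbar t + lam * (1 / A α t - 1)) / 2 * ‖z - y (t + 1)‖ ^ 2
      + β / 12 * ‖z - y (t + 1)‖ ^ 3) (t : ℕ) (z : E n) :
    f (x (t + 1)) - f z ≤ A α t *
      ((μu + μbar t) / 2 * ‖x 0 - z‖ ^ 2 + (2 * γ + β) / 6 * ‖x 0 - z‖ ^ 3) := by
  have hl : ∀ p z, lowerModel f lam p z ≤ f z := fun p z =>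
    gradient_inequality (hf.differentiable (by norm_num)) hconv p z
  have hA := A_pos hrun.α_mem t
  have hw0 := hrun.w_zero
  have h0 := hH 0
  rw [hw0] at h0
  have hx1 := le_of_isMinOn_cubicModel hf hLip (hμ 0).1 h0.1 h0.2 hrun.x_one z
  have hx1' : f (x 1) ≤ f z + (μu / 2 * ‖z - x 0‖ ^ 2 + γ / 3 * ‖z - x 0‖ ^ 3) := by
    have : μ 0 / 2 * ‖z - x 0‖ ^ 2 ≤ μu / 2 * ‖z - x 0‖ ^ 2 := by
      have := (hμ 0).2
      gcongr
    linarith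
  have hup := estimateFn_le (β := β) (μbar := μbar) hrun.α_mem hx1' (fun p => hl p z) t
  have hlow := div_A_le_estimateFn hrun hl hstep t z
  have h := mul_le_mul_of_nonneg_left (hlow.trans hup) hA.le
  rw [mul_div_cancel₀ _ hA.ne'] at h
  have e : A α t * (f z / A α t + (μu / 2 * ‖z - x 0‖ ^ 2 + γ / 3 * ‖z - x 0‖ ^ 3)
      + μbar t / 2 * ‖z - x 0‖ ^ 2 + β / 6 * ‖z - x 0‖ ^ 3)
      = f z + A α t * ((μu + μbar t) / 2 * ‖z - x 0‖ ^ 2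
        + (2 * γ + β) / 6 * ‖z - x 0‖ ^ 3) := by
    field_simp
    ring
  rw [norm_sub_rev (x 0)]
  linarith

end EstimateSequence

end AINCR
-- Parameter inequalities.
namespace AINCR

variable {n : ℕ}

/-- Cauchy–Schwarz reduces the linear term to -a‖g‖‖v‖, and the alignment estimate is used with u =
a‖v‖. -/
theorem step_nonneg {g v : E n} {D μ γ a A₁ P : ℝ} (ha : 0 ≤ a) (hA : 0 < A₁)
    (hkey : ∀ u : ℝ, 0 ≤ u → ‖g‖ * u ≤ D + 3 / 8 * μ * u ^ 2 + 8 / 9 * γ * u ^ 3)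
    (hP : 3 / 8 * μ * (a * ‖v‖) ^ 2 + 8 / 9 * γ * (a * ‖v‖) ^ 3 ≤ A₁ * P) :
    0 ≤ 1 / A₁ * D + a / A₁ * inner ℝ g v + P := by
  have h1 := hkey (a * ‖v‖) (by positivity)
  have h2 := (abs_le.1 (abs_real_inner_le_norm g v)).1
  have h3 := mul_le_mul_of_nonneg_left h2 ha
  have e : 1 / A₁ * D + a / A₁ * inner ℝ g v + P = (D + a * inner ℝ g v + A₁ * P) / A₁ := by
    field_simp
  rw [e]
  apply div_nonneg _ hA.le
  linarith

section AlphaHat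

variable {lam γ μu Rbar : ℝ}

theorem alphaHat_nonneg (hlam : 0 < lam) (hγ : 0 < γ) (hR : 0 < Rbar) :
    0 ≤ alphaHat lam γ μu Rbar := by
  have h : 0 ≤ (1 / 4) * (lam / (γ * Rbar)) ^ (1 / 3 : ℝ) := by positivity
  rw [alphaHat]
  split_ifs
  · exact le_min (by norm_num) h
  · exact le_min (by norm_num) (le_min (Real.sqrt_nonneg _) h)

theorem alphaHat_le : alphaHat lam γ μu Rbar ≤ 8 / 9 := by
  rw [alphaHat]
  split_ifs <;> exact min_le_left _ _

/-- The constant 27 comes from 18√3 ≥ 27, that is √3 ≥ 3/2. -/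
theorem mul_alphaHat_sq_le (hlam : 0 < lam) (hγ : 0 < γ) (hR : 0 < Rbar) (hμ : 0 ≤ μu) :
    μu * alphaHat lam γ μu Rbar ^ 2 ≤ lam / 27 := by
  rcases hμ.eq_or_lt with rfl | hμ
  · rw [zero_mul]; positivity
  have hle : alphaHat lam γ μu Rbar ≤ √(lam / (18 * √3 * μu)) := by
    rw [alphaHat, if_neg hμ.ne']
    exact (min_le_right _ _).trans (min_le_left _ _)
  have h := pow_le_pow_left₀ (alphaHat_nonneg hlam hγ hR) hle 2
  rw [Real.sq_sqrt (by positivity)] at h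
  have h3 : (3 / 2 : ℝ) ≤ √3 := Real.le_sqrt_of_sq_le (by norm_num)
  calc μu * alphaHat lam γ μu Rbar ^ 2 ≤ μu * (lam / (18 * √3 * μu)) := by gcongr
    _ = lam / (18 * √3) := by field_simp
    _ ≤ lam / 27 := by gcongr; linarith

theorem mul_alphaHat_cube_le (hlam : 0 < lam) (hγ : 0 < γ) (hR : 0 < Rbar) :
    γ * alphaHat lam γ μu Rbar ^ 3 ≤ lam / (64 * Rbar) := by
  have hle : alphaHat lam γ μu Rbar ≤ (1 / 4) * (lam / (γ * Rbar)) ^ (1 / 3 : ℝ) := by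
    rw [alphaHat]
    split_ifs
    · exact min_le_right _ _
    · exact (min_le_right _ _).trans (min_le_right _ _)
  have h := pow_le_pow_left₀ (alphaHat_nonneg hlam hγ hR) hle 3
  have hpow : ((lam / (γ * Rbar)) ^ (1 / 3 : ℝ)) ^ 3 = lam / (γ * Rbar) := by
    rw [← Real.rpow_natCast, ← Real.rpow_mul (by positivity)]
    norm_num
  rw [mul_pow, hpow] at h
  calc γ * alphaHat lam γ μu Rbar ^ 3 ≤ γ * ((1 / 4) ^ 3 * (lam / (γ * Rbar))) := by gcongr
    _ = lam / (64 * Rbar) := by field_simp; norm_num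

end AlphaHat

theorem A_of_const {α : ℕ → ℝ} {a : ℝ} (h : ∀ t, 1 ≤ t → α t = a) (t : ℕ) :
    A α t = (1 - a) ^ t := by
  induction t with
  | zero => simp [A_zero]
  | succ t ih => rw [A_succ, ih, h _ (by omega), pow_succ]

/-- The factors 1 - α_i = i/(i + 3) telescope. -/
theorem A_of_harmonic {α : ℕ → ℝ} (h : ∀ t : ℕ, α t = 3 / ((t : ℝ) + 3)) (t : ℕ) :
    A α t = 6 / (((t : ℝ) + 1) * (t + 2) * (t + 3)) := by
  induction t with
  | zero => simp [A_zero]; norm_num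
  | succ t ih =>
    rw [A_succ, ih, h]
    push_cast
    field_simp
    ring

/-- On a ball of radius `Rbar`, half of the quadratic growth compensates for the fixed cubic
coefficient. -/
theorem scaled_growth_le {lam R v a A₀ μ γ : ℝ} (hlam : 0 < lam) (hR : 0 < R) (hv : 0 ≤ v)
    (hvR : v ≤ R) (hA : 0 < A₀) (hA1 : A₀ ≤ 1) (ha : a ≤ 8 / 9)
    (h2 : μ * a ^ 2 ≤ lam / 27) (h3 : γ * a ^ 3 ≤ lam / (64 * R)) :
    3 / 8 * μ * (a * v) ^ 2 + 8 / 9 * γ * (a * v) ^ 3 ≤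
      A₀ * (1 - a) * ((lam / 4 + lam / 2 * (1 / A₀ - 1)) / 2 * v ^ 2
        + 3 * lam / (2 * R) / 12 * v ^ 3) := by
  have hc : v ^ 3 / R ≤ v ^ 2 := by
    rw [div_le_iff₀ hR, pow_succ]
    exact mul_le_mul_of_nonneg_left hvR (sq_nonneg v)
  have hv2 : 0 ≤ v ^ 2 := sq_nonneg v
  have hv3 : 0 ≤ v ^ 3 := by positivity
  have e : A₀ * (1 - a) * ((lam / 4 + lam / 2 * (1 / A₀ - 1)) / 2 * v ^ 2
        + 3 * lam / (2 * R) / 12 * v ^ 3)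
      = (1 - a) * (lam / 8 * v ^ 2 + lam / 8 * (v ^ 3 / R)
        + lam / 8 * ((1 - A₀) * (v ^ 2 - v ^ 3 / R))) := by
    field_simp
    ring
  have h4 : 0 ≤ lam / 8 * ((1 - A₀) * (v ^ 2 - v ^ 3 / R)) :=
    mul_nonneg (by positivity) (mul_nonneg (by linarith) (by linarith))
  have h5 : 0 ≤ lam / 8 * v ^ 2 + lam / 8 * (v ^ 3 / R) := by positivity
  have h6 := mul_le_mul_of_nonneg_right h2 hv2
  have h7 := mul_le_mul_of_nonneg_right h3 hv3
  have e7 : lam / (64 * R) * v ^ 3 = lam / 64 * (v ^ 3 / R) := by field_simp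
  rw [e7] at h7
  rw [e]
  -- The cap a ≤ 8/9 gives 1 - a ≥ 1/9, and the constants then match exactly: (3/8)(1/27) =
  -- (8/9)(1/64) = (1/9)(1/8).
  have h8 : 1 / 9 * (lam / 8 * v ^ 2 + lam / 8 * (v ^ 3 / R)) ≤
      (1 - a) * (lam / 8 * v ^ 2 + lam / 8 * (v ^ 3 / R)
        + lam / 8 * ((1 - A₀) * (v ^ 2 - v ^ 3 / R))) :=
    mul_le_mul (by linarith) (by linarith) h5 (by linarith)
  linarith [mul_nonneg hlam.le hv2]

end AINCR

/-! ### The two convergence rates. -/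

theorem mainTheorem5 {n : ℕ} (f : AINCR.E n → ℝ) (hf : ContDiff ℝ 2 f)
    (γ : ℝ) (hγ : 0 < γ)
    (hLip : ∀ z z' : AINCR.E n, ‖AINCR.hess f z - AINCR.hess f z'‖ ≤ γ * ‖z - z'‖)
    (xstar : AINCR.E n) (hstar : IsMinOn f Set.univ xstar)
    (lam η β : ℝ) (α μbar : ℕ → ℝ)
    (H : ℕ → AINCR.E n →L[ℝ] AINCR.E n) (x y w : ℕ → AINCR.E n)
    (hrun : AINCR.IsRun f γ lam η β α μbar H x y w)
    (μ : ℕ → ℝ) (μu : ℝ) (hμ : ∀ t, 0 ≤ μ t ∧ μ t ≤ μu)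
    (hH : ∀ t,
      (μ t / 2) • (1 : AINCR.E n →L[ℝ] AINCR.E n) ≤ H t - AINCR.hess f (w t) ∧
      H t - AINCR.hess f (w t) ≤ μ t • (1 : AINCR.E n →L[ℝ] AINCR.E n)) :
    (0 < lam → StrongConvexOn Set.univ lam f →
      ∀ (xbar : ℕ → AINCR.E n) (R : ℕ → ℝ) (Rbar : ℝ),
        (∀ t, 1 ≤ t →
          IsMinOn (AINCR.auxObjective f lam β α μbar x y t) Set.univ (xbar t)) →
        (∀ t, 1 ≤ t → ‖xbar t - y t‖ ≤ R t) →
        0 < Rbar → (∀ t, 1 ≤ t → R t ≤ Rbar) →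
        (∀ t, 1 ≤ t → α t = AINCR.alphaHat lam γ μu Rbar) →
        (∀ t, μbar t = lam / 4) →
        β = 3 * lam / (2 * Rbar) → η = 4 * γ →
        ∀ t, 1 ≤ t →
          f (x t) - f xstar ≤
            2 * (1 - AINCR.alphaHat lam γ μu Rbar) ^ (t - 1) * (f (x 0) - f xstar) *
              ((2 * μu * lam⁻¹ + 1) / 4 +
                (4 * γ * lam⁻¹ + 3 * Rbar⁻¹) / 12 * ‖x 0 - xstar‖)) ∧
    (lam = 0 → ConvexOn ℝ Set.univ f →
      (∀ t, α t = 3 / ((t : ℝ) + 3)) →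
      (∀ t, μbar t = 2 * μu * ((t : ℝ) + 2)) →
      β = 96 * γ → η = 4 * γ →
      ∀ t : ℕ, 1 ≤ t →
        f (x t) - f xstar ≤
          98 * γ * ‖x 0 - xstar‖ ^ 3 / ((t : ℝ) * ((t : ℝ) + 1) * ((t : ℝ) + 2)) +
          12 * μu * ‖x 0 - xstar‖ ^ 2 / ((t : ℝ) * ((t : ℝ) + 2))) := by
  have hμu : 0 ≤ μu := (hμ 0).1.trans (hμ 0).2
  have hkey : η = 4 * γ → ∀ (t : ℕ) (u : ℝ), 0 ≤ u → ‖gradient f (x (t + 2))‖ * u ≤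
      inner ℝ (gradient f (x (t + 2))) (w (t + 1) - x (t + 2)) + 3 / 8 * μu * u ^ 2
        + 8 / 9 * γ * u ^ 3 := fun hη t u hu => by
    have hx := hrun.x_succ (t + 1) (by omega)
    rw [hη] at hx
    have h := AINCR.norm_gradient_mul_le_of_isMinOn hf hγ hLip (hμ (t + 1)).1 (hH (t + 1)).1
      (hH (t + 1)).2 hx hu
    have : 3 / 8 * μ (t + 1) * u ^ 2 ≤ 3 / 8 * μu * u ^ 2 := by
      have := (hμ (t + 1)).2
      gcongr
    linarith
  constructor
  · intro hlam hconv xbar R Rbar hxbar hR hRbar hRR hα hμbar hβ hη t ht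
    obtain ⟨t, rfl⟩ : ∃ s, t = s + 1 := ⟨t - 1, by omega⟩
    have ha0 := AINCR.alphaHat_nonneg (μu := μu) hlam hγ hRbar
    have ha1 := AINCR.alphaHat_le (lam := lam) (γ := γ) (μu := μu) (Rbar := Rbar)
    have ha2 := AINCR.mul_alphaHat_sq_le hlam hγ hRbar hμu
    have ha3 := AINCR.mul_alphaHat_cube_le (μu := μu) hlam hγ hRbar
    set a := AINCR.alphaHat lam γ μu Rbar
    have hbound := AINCR.sub_le_of_isRun hf hLip hrun hμ hH hconv (fun t z => by
      have hA := AINCR.A_pos hrun.α_mem t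
      have hA1 := AINCR.A_pos hrun.α_mem (t + 1)
      have hAle : AINCR.A α t ≤ 1 := by
        rw [AINCR.A_of_const hα]
        exact pow_le_one₀ (by linarith) (by linarith)
      -- The radius bound is available only at x̄_{t+1}. Nonnegativity is proved there, and
      -- minimality of the auxiliary objective transfers it to every z.
      have hmin := hxbar (t + 1) (by omega) (Set.mem_univ z)
      have hst := AINCR.step_nonneg (v := xbar (t + 1) - y (t + 1))
        (P := (μbar t + AINCR.lamBar lam α (t + 1)) / 2 * ‖xbar (t + 1) - y (t + 1)‖ ^ 2
          + β / 12 * ‖xbar (t + 1) - y (t + 1)‖ ^ 3)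
        (hrun.α_mem (t + 1) (by omega)).1.le hA1 (hkey hη t) (by
          rw [AINCR.A_succ, hα (t + 1) (by omega), hμbar, hβ]
          exact AINCR.scaled_growth_le hlam hRbar (norm_nonneg _)
            ((hR _ (by omega)).trans (hRR _ (by omega))) hA hAle ha1 ha2 ha3)
      simp only [Set.mem_ofPred_eq, AINCR.auxObjective, Nat.add_sub_cancel] at hmin
      have hlb : AINCR.lamBar lam α (t + 1) ≤ lam * (1 / AINCR.A α t - 1) := by
        have h1 : 0 ≤ 1 / AINCR.A α t - 1 := by
          rw [sub_nonneg, le_div_iff₀ hA]; linarith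
        rw [AINCR.lamBar, Nat.add_sub_cancel]
        exact mul_le_mul_of_nonneg_right (by linarith) h1
      have hz : (μbar t + AINCR.lamBar lam α (t + 1)) / 2 * ‖z - y (t + 1)‖ ^ 2 ≤
          (μbar t + lam * (1 / AINCR.A α t - 1)) / 2 * ‖z - y (t + 1)‖ ^ 2 := by gcongr
      linarith) t xstar
    have hgrad : gradient f xstar = 0 := by
      have := (hstar.isLocalMin Filter.univ_mem).fderiv_eq_zero
      simp [gradient, this]
    have hgrow := AINCR.gradient_inequality (hf.differentiable (by norm_num)) hconv xstar (x 0)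
    rw [hgrad, inner_zero_left, add_zero] at hgrow
    rw [AINCR.A_of_const hα] at hbound
    refine hbound.trans ?_
    rw [Nat.add_sub_cancel,
      show ∀ P F K : ℝ, 2 * P * F * K = P * (2 * (F * K)) from fun _ _ _ => by ring]
    refine mul_le_mul_of_nonneg_left ?_ (pow_nonneg (by linarith) _)
    rw [hμbar, hβ]
    set d := ‖x 0 - xstar‖
    have hd : 0 ≤ d := norm_nonneg _
    have hK : 0 ≤ (2 * μu * lam⁻¹ + 1) / 4 + (4 * γ * lam⁻¹ + 3 * Rbar⁻¹) / 12 * d := by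
      positivity
    -- Weakening λ/4 to λ/2 allows the factor (λ/2)d² to be split off, which strong convexity bounds
    -- by f(x₀) - f(x_*).
    calc (μu + lam / 4) / 2 * d ^ 2 + (2 * γ + 3 * lam / (2 * Rbar)) / 6 * d ^ 3
        ≤ (μu + lam / 2) / 2 * d ^ 2 + (2 * γ + 3 * lam / (2 * Rbar)) / 6 * d ^ 3 := by
          gcongr; linarith
      _ = 2 * (lam / 2 * d ^ 2 *
            ((2 * μu * lam⁻¹ + 1) / 4 + (4 * γ * lam⁻¹ + 3 * Rbar⁻¹) / 12 * d)) := by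
          field_simp
          ring
      _ ≤ _ := by
          refine mul_le_mul_of_nonneg_left ?_ zero_le_two
          exact mul_le_mul_of_nonneg_right (by linarith) hK
  · intro hlam hconv hα hμbar hβ hη t ht
    obtain ⟨t, rfl⟩ : ∃ s, t = s + 1 := ⟨t - 1, by omega⟩
    have hbound := AINCR.sub_le_of_isRun hf hLip hrun hμ hH
      (by rw [hlam]; exact strongConvexOn_zero.2 hconv) (fun t z => by
      have hst := AINCR.step_nonneg (v := z - y (t + 1))
        (P := (μbar t + lam * (1 / AINCR.A α t - 1)) / 2 * ‖z - y (t + 1)‖ ^ 2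
          + β / 12 * ‖z - y (t + 1)‖ ^ 3)
        (hrun.α_mem (t + 1) (by omega)).1.le (AINCR.A_pos hrun.α_mem (t + 1)) (hkey hη t) (by
          rw [AINCR.A_of_harmonic hα, hα, hμbar, hβ, hlam, zero_mul, add_zero]
          push_cast
          set v := ‖z - y (t + 1)‖
          have hv : 0 ≤ v := norm_nonneg _
          have ht : (0 : ℝ) ≤ t := t.cast_nonneg
          have e1 : 3 / 8 * μu * (3 / ((t : ℝ) + 1 + 3) * v) ^ 2
              ≤ 6 / (((t : ℝ) + 1 + 1) * (t + 1 + 2) * (t + 1 + 3))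
                * (2 * μu * (t + 2) / 2 * v ^ 2) := by
            have : 6 / (((t : ℝ) + 1 + 1) * (t + 1 + 2) * (t + 1 + 3))
                * (2 * μu * (t + 2) / 2 * v ^ 2) = μu * v ^ 2 * (6 / ((t + 3) * (t + 4))) := by
              field_simp
              ring
            rw [this]
            have : 3 / 8 * μu * (3 / ((t : ℝ) + 1 + 3) * v) ^ 2
                = μu * v ^ 2 * (27 / 8 / ((t + 4) * (t + 4))) := by
              field_simp
              ring
            rw [this]
            -- Only 27/8 ≤ 6 and t + 3 ≤ t + 4 are needed.
            gcongr <;> norm_num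
          have e2 : 8 / 9 * γ * (3 / ((t : ℝ) + 1 + 3) * v) ^ 3
              ≤ 6 / (((t : ℝ) + 1 + 1) * (t + 1 + 2) * (t + 1 + 3))
                * (96 * γ / 12 * v ^ 3) := by
            have : 6 / (((t : ℝ) + 1 + 1) * (t + 1 + 2) * (t + 1 + 3))
                * (96 * γ / 12 * v ^ 3)
                = γ * v ^ 3 * (48 / ((t + 2) * (t + 3) * (t + 4))) := by
              field_simp
              ring
            rw [this]
            have : 8 / 9 * γ * (3 / ((t : ℝ) + 1 + 3) * v) ^ 3
                = γ * v ^ 3 * (24 / ((t + 4) * (t + 4) * (t + 4))) := by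
              field_simp
              ring
            rw [this]
            gcongr <;> norm_num
          rw [mul_add]
          exact add_le_add e1 e2)
      linarith) t xstar
    rw [AINCR.A_of_harmonic hα, hμbar, hβ] at hbound
    refine hbound.trans ?_
    push_cast
    set d := ‖x 0 - xstar‖
    have ht : (0 : ℝ) ≤ t := t.cast_nonneg
    -- The cubic part is exact, with 98 = 2 + 96; the quadratic part has slack, since (6t + 15)/(t +
    -- 2) ≤ 12.
    have e : 6 / (((t : ℝ) + 1) * (t + 2) * (t + 3)) * ((μu + 2 * μu * (t + 2)) / 2 * d ^ 2
          + (2 * γ + 96 * γ) / 6 * d ^ 3)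
        = 98 * γ * d ^ 3 / (((t : ℝ) + 1) * (t + 1 + 1) * (t + 1 + 2))
          + (6 * t + 15) / (t + 2) * (μu * d ^ 2 / ((t + 1) * (t + 1 + 2))) := by
      field_simp
      ring
    have e2 : 12 * μu * d ^ 2 / (((t : ℝ) + 1) * (t + 1 + 2))
        = 12 * (μu * d ^ 2 / ((t + 1) * (t + 1 + 2))) := by ring
    rw [e, e2]
    gcongr
    rw [div_le_iff₀ (by positivity)]
    linarith
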